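/- Use the Fourier transform $\widehat f(\xi)=\int_{\mathbb R}f(t)e^{-i\xi t}\,dt$, extended to $L^2(\mathbb R)$, and let $H^2(\mathbb C^+)=\{f\in L^2(\mathbb R):\widehat f(\xi)=0\text{ for a.e. }\xi<0\}$, with the inner product $\langle f,g\rangle=\int_{\mathbb R} f\overline g\,dt$, be the Hardy space of the upper half plane $\mathbb C^+$. For $z=x+is\in\mathbb C^+$ (identified with the element $(x,s)$ of the $ax+b$ group) let $\pi(z)\psi(t)=s^{-1/2}\psi(s^{-1}(t-x))$, let $W_\psi f(z)=\langle f,\pi(z)\psi\rangle$ for $f,\psi\in H^2(\mathbb C^+)$, and let $d\mu^+(z)=s^{-2}\,dx\,ds$. For $\alpha>0$ and $n\in\mathbb N_0$ let $\psi_n^\alpha\in H^2(\mathbb C^+)$ be the function with $$\widehat{\psi_n^\alpha}(t)=\sqrt{\frac{2^{\alpha+2}\pi\, n!}{\Gamma(n+\alpha+1)}}\;t^{\alpha/2}e^{-t}L_n^\alpha(2t)\quad(t>0),\qquad L_n^\alpha(t)=\sum_{k=0}^n\frac{(-1)^k}{k!}\binom{n+\alpha}{n-k}t^k .$$ (i)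 If $n\in\mathbb N_0$ and $\alpha>1$, then $\psi_n^\alpha$ is an integrable vector for $\pi$, that is, $$\int_{\mathbb C^+}\big|\langle\psi_n^\alpha,\pi(z)\psi_n^\alpha\rangle\big|\,d\mu^+(z)<\infty .$$ (ii) If $\alpha>0$ and $p\in\mathbb R$ satisfy $(\alpha+1)p-2>0$, then $|W_{\psi_0^\alpha}\psi_0^\alpha|^p$ is $\mu^+$-integrable and $$\int_{\mathbb C^+}\big|W_{\psi_0^\alpha}\psi_0^\alpha(z)\big|^p\,d\mu^+(z)=\frac{8\pi}{(\alpha+1)p-2}.$$ -/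

import Mathlib

open MeasureTheory FourierTransform
open scoped ENNReal

noncomputable section

/-- The Hilbert space `L²(ℝ)` of complex-valued functions (with Lebesgue measure). -/
abbrev L2R : Type := Lp ℂ 2 (volume : Measure ℝ)

/-- The `L²`-Fourier transform in the normalization `f̂(ξ) = ∫ f(t) e^{-iξt} dt`.
Mathlib's transform `𝓕` is normalized by `𝓕 f(y) = ∫ f(t) e^{-2πiyt} dt`,
so that `f̂(ξ) = 𝓕 f(ξ / (2π))`. -/
def fourierHat (f : L2R) (ξ : ℝ) : ℂ := (𝓕 f : L2R) (ξ / (2 * Real.pi))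

/-- Scaling by a nonzero constant and translating preserves null sets. -/
lemma quasiMeasurePreserving_affine {a : ℝ} (ha : a ≠ 0) (x : ℝ) :
    Measure.QuasiMeasurePreserving (fun t : ℝ => (t - x) / a) volume volume := by
  refine ⟨by fun_prop, ?_⟩
  have h1 : (volume : Measure ℝ).map (fun t : ℝ => (t - x) / a)
      = ((volume : Measure ℝ).map (fun t : ℝ => t - x)).map (fun t : ℝ => a⁻¹ * t) := by
    rw [Measure.map_map (by fun_prop) (by fun_prop)]
    congr 1
    funext t
    simp [div_eq_inv_mul]
  rw [h1, (measurePreserving_sub_right (volume : Measure ℝ) x).map_eq,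
    Real.map_volume_mul_left (inv_ne_zero ha)]
  exact Measure.smul_absolutelyContinuous

lemma quasiMeasurePreserving_div {a : ℝ} (ha : a ≠ 0) :
    Measure.QuasiMeasurePreserving (fun t : ℝ => t / a) volume volume := by
  simpa using quasiMeasurePreserving_affine ha 0

lemma fourierHat_zero : fourierHat 0 =ᵐ[volume] 0 := by
  have h : (𝓕 (0 : L2R) : L2R) = 0 := (Lp.fourierTransformₗᵢ ℝ ℂ).map_zero
  have h0 : ((𝓕 (0 : L2R) : L2R) : ℝ → ℂ) =ᵐ[volume] 0 := by
    rw [h]; exact Lp.coeFn_zero ℂ 2 volume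
  exact (quasiMeasurePreserving_div (by positivity : 2 * Real.pi ≠ 0)).ae_eq_comp h0

lemma fourierHat_add (f g : L2R) :
    fourierHat (f + g) =ᵐ[volume] fun ξ => fourierHat f ξ + fourierHat g ξ := by
  have h : (𝓕 (f + g) : L2R) = 𝓕 f + 𝓕 g := (Lp.fourierTransformₗᵢ ℝ ℂ).map_add f g
  have h0 : ((𝓕 (f + g) : L2R) : ℝ → ℂ) =ᵐ[volume] ((𝓕 f : L2R) : ℝ → ℂ) + (𝓕 g : L2R) := by
    rw [h]; exact Lp.coeFn_add _ _
  exact (quasiMeasurePreserving_div (by positivity : 2 * Real.pi ≠ 0)).ae_eq_comp h0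

lemma fourierHat_smul (c : ℂ) (f : L2R) :
    fourierHat (c • f) =ᵐ[volume] fun ξ => c * fourierHat f ξ := by
  have h : (𝓕 (c • f) : L2R) = c • 𝓕 f := (Lp.fourierTransformₗᵢ ℝ ℂ).map_smul c f
  have h0 : ((𝓕 (c • f) : L2R) : ℝ → ℂ) =ᵐ[volume] c • ((𝓕 f : L2R) : ℝ → ℂ) := by
    rw [h]; exact Lp.coeFn_smul _ _
  exact (quasiMeasurePreserving_div (by positivity : 2 * Real.pi ≠ 0)).ae_eq_comp h0

/-- The Hardy space `H²(ℂ⁺)` of the upper half plane, identified with the space of boundary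
values: the `f ∈ L²(ℝ)` with `f̂(ξ) = 0` for almost every `ξ < 0`, with the inner product and
norm of `L²(ℝ)`. -/
def HardySpace : Submodule ℂ L2R where
  carrier := {f | ∀ᵐ ξ : ℝ, ξ < 0 → fourierHat f ξ = 0}
  zero_mem' := by
    filter_upwards [fourierHat_zero] with ξ h _
    simpa using h
  add_mem' := by
    intro f g hf hg
    filter_upwards [hf, hg, fourierHat_add f g] with ξ h1 h2 h3 hξ
    rw [h3, h1 hξ, h2 hξ, add_zero]
  smul_mem' := by
    intro c f hf
    filter_upwards [hf, fourierHat_smul c f] with ξ h1 h2 hξ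
    rw [h2, h1 hξ, mul_zero]

lemma memLp_affineAction (z : UpperHalfPlane) (f : L2R) :
    MemLp (fun t : ℝ => ((z.im ^ (-(1 / 2 : ℝ)) : ℝ) : ℂ) * f ((t - z.re) / z.im)) 2 volume := by
  have hz : z.im ≠ 0 := z.im_pos.ne'
  refine MemLp.const_mul ?_ _
  have h1 : (volume : Measure ℝ).map (fun t : ℝ => (t - z.re) / z.im)
      = ENNReal.ofReal |z.im⁻¹⁻¹| • volume := by
    have h2 : (volume : Measure ℝ).map (fun t : ℝ => (t - z.re) / z.im)
        = ((volume : Measure ℝ).map (fun t : ℝ => t - z.re)).map (fun t : ℝ => z.im⁻¹ * t) := by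
      rw [Measure.map_map (by fun_prop) (by fun_prop)]
      congr 1
      funext t
      simp [div_eq_inv_mul]
    rw [h2, (measurePreserving_sub_right (volume : Measure ℝ) z.re).map_eq,
      Real.map_volume_mul_left (inv_ne_zero hz)]
  refine MemLp.comp_of_map (g := (f : ℝ → ℂ)) (f := fun t : ℝ => (t - z.re) / z.im) ?_
    (by fun_prop)
  rw [h1]
  exact (Lp.memLp f).smul_measure ENNReal.ofReal_ne_top

/-- The representation of the `ax + b` group, the point `z = x + is` of the upper half plane
being identified with the group element `(x, s)`: `π(z)f(t) = s^{-1/2} f((t - x)/s)`. -/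
def affineAction (z : UpperHalfPlane) (f : L2R) : L2R :=
  (memLp_affineAction z f).toLp
    (fun t : ℝ => ((z.im ^ (-(1 / 2 : ℝ)) : ℝ) : ℂ) * f ((t - z.re) / z.im))

/-- The continuous analytic wavelet transform `W_ψ f(z) = ⟨f, π(z)ψ⟩`, the inner product being
linear in `f` (Mathlib's `inner` is linear in its second argument). -/
def waveletTransform (ψ f : HardySpace) (z : UpperHalfPlane) : ℂ :=
  inner ℂ (affineAction z (ψ : L2R)) (f : L2R)

/-- The generalized Laguerre polynomial `L_n^α`, as a function on `ℝ`. -/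
def laguerreGen (n : ℕ) (α t : ℝ) : ℝ :=
  ∑ k ∈ Finset.range (n + 1),
    (-1) ^ k / (k.factorial : ℝ) * Ring.choose ((n : ℝ) + α) (n - k) * t ^ k

/-- The Fourier transform of `ψ_n^α`, extended by zero to the negative half-line. -/
def psiHat (n : ℕ) (α t : ℝ) : ℝ :=
  if 0 < t then
    Real.sqrt (2 ^ (α + 2) * Real.pi * n.factorial / Real.Gamma (n + α + 1)) *
      t ^ (α / 2) * Real.exp (-t) * laguerreGen n α (2 * t)
  else 0

lemma memLp_rpow_mul_exp {b : ℝ} (hb : 0 < b) :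
    MemLp (fun t : ℝ => if 0 < t then t ^ b * Real.exp (-t) else 0) 2 volume := by
  have hmeas : Measurable (fun t : ℝ => if 0 < t then t ^ b * Real.exp (-t) else 0) :=
    Measurable.ite measurableSet_Ioi (by fun_prop) measurable_const
  rw [memLp_two_iff_integrable_sq hmeas.aestronglyMeasurable]
  have h : IntegrableOn (fun t : ℝ => t ^ (2 * b) * Real.exp (-2 * t ^ (1 : ℝ)))
      (Set.Ioi 0) volume :=
    integrableOn_rpow_mul_exp_neg_mul_rpow (by linarith) one_pos two_pos
  rw [← integrable_indicator_iff measurableSet_Ioi] at h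
  refine h.congr (Filter.Eventually.of_forall fun t => ?_)
  by_cases ht : 0 < t
  · have e1 : t ^ (2 * b) = (t ^ b) ^ 2 := by
      rw [mul_comm, Real.rpow_mul ht.le]; norm_num
    have e2 : Real.exp (-2 * t) = Real.exp (-t) ^ 2 := by
      rw [← Real.exp_nat_mul]; congr 1; push_cast; ring
    simp [Set.indicator, ht, mul_pow, e1, ← e2]
  · simp [Set.indicator, ht]

lemma memLp_psiHat (n : ℕ) {α : ℝ} (hα : 0 < α) : MemLp (psiHat n α) 2 volume := by
  have h : psiHat n α = fun t => ∑ k ∈ Finset.range (n + 1),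
      (Real.sqrt (2 ^ (α + 2) * Real.pi * n.factorial / Real.Gamma (n + α + 1)) *
        ((-1) ^ k / (k.factorial : ℝ) * Ring.choose ((n : ℝ) + α) (n - k) * 2 ^ k)) *
      (if 0 < t then t ^ (α / 2 + k) * Real.exp (-t) else 0) := by
    funext t
    by_cases ht : 0 < t
    · simp only [psiHat, ht, if_true, laguerreGen, Finset.mul_sum]
      refine Finset.sum_congr rfl fun k _ => ?_
      rw [Real.rpow_add ht, Real.rpow_natCast, mul_pow]
      ring
    · simp [psiHat, ht]
  rw [h]
  refine memLp_finsetSum _ fun k _ => MemLp.const_mul ?_ _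
  exact memLp_rpow_mul_exp (by positivity)

/-- `y ↦ ψ̂_n^α(2πy)`, the transform of `ψ_n^α` in Mathlib's normalization. -/
lemma memLp_psiHat_scaled (n : ℕ) {α : ℝ} (hα : 0 < α) :
    MemLp (fun y : ℝ => ((psiHat n α (2 * Real.pi * y) : ℝ) : ℂ)) 2 volume := by
  have hπ : 2 * Real.pi ≠ 0 := by positivity
  refine MemLp.ofReal ?_
  refine MemLp.comp_of_map (g := psiHat n α) (f := fun y : ℝ => 2 * Real.pi * y) ?_ (by fun_prop)
  rw [Real.map_volume_mul_left hπ]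
  exact (memLp_psiHat n hα).smul_measure ENNReal.ofReal_ne_top

/-- `ψ_n^α` as an element of `L²(ℝ)`: the function whose Fourier transform is `psiHat n α`
(see `fourierHat_psiL2`). -/
def psiL2 (n : ℕ) (α : ℝ) (hα : 0 < α) : L2R :=
  𝓕⁻ ((memLp_psiHat_scaled n hα).toLp
    (fun y : ℝ => ((psiHat n α (2 * Real.pi * y) : ℝ) : ℂ)))

lemma fourierHat_psiL2 (n : ℕ) {α : ℝ} (hα : 0 < α) :
    fourierHat (psiL2 n α hα) =ᵐ[volume] fun ξ => ((psiHat n α ξ : ℝ) : ℂ) := by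
  have hπ : 2 * Real.pi ≠ 0 := by positivity
  have h : (𝓕 (psiL2 n α hα) : L2R) = (memLp_psiHat_scaled n hα).toLp
      (fun y : ℝ => ((psiHat n α (2 * Real.pi * y) : ℝ) : ℂ)) :=
    (Lp.fourierTransformₗᵢ ℝ ℂ).apply_symm_apply _
  have h0 := (memLp_psiHat_scaled n hα).coeFn_toLp
  rw [← h] at h0
  filter_upwards [(quasiMeasurePreserving_div hπ).ae_eq_comp h0] with ξ hξ
  simp only [Function.comp] at hξ
  rw [fourierHat, hξ, mul_div_cancel₀ _ hπ]

/-- The wavelet `ψ_n^α`, an element of the Hardy space. -/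
def psi (n : ℕ) (α : ℝ) (hα : 0 < α) : HardySpace :=
  ⟨psiL2 n α hα, by
    change ∀ᵐ ξ : ℝ, ξ < 0 → fourierHat (psiL2 n α hα) ξ = 0
    filter_upwards [fourierHat_psiL2 n hα] with ξ h hξ
    rw [h, psiHat, if_neg (not_lt.mpr hξ.le), Complex.ofReal_zero]⟩

end

noncomputable section

/-! On the Fourier side `π(x + is)` acts by `g(ξ) ↦ s^{1/2} e^{-ixξ} g(sξ)`, and the transform of
`ψ_n^α` is a finite combination of functions `t^{α/2+k} e^{-t}`. By Plancherel, pairing two of these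
is a Gamma integral with complex rate `D = 1 + s - ix`. Hence the wavelet transform is a finite sum
of constants times `s^{(α+1)/2+k} D^{-(α+j+k+1)}` (`waveletTransform_psi_eq_sum`).

Since `s ≤ |D|` and `1 ≤ |D|`, every term is bounded by a multiple of `P^{(α+1)/2}`, where `P =
4s/|D|^2`. For `n = 0` there is a single term, and the normalization of `ψ_0^α` makes its modulus
exactly `P^{(α+1)/2}` (`norm_waveletTransform_psi_zero`).

Both claims thus reduce to `∫ P^q dμ⁺ = 4π/(q - 1)` for `q > 1` (`lintegral_poissonKernel_rpow`).
The `x`-integral is a Gamma quotient, the `s`-integral is a Beta integral, and the duplication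
formula collapses the product. Take `q = (α+1)/2` for (i) and `q = (α+1)p/2` for (ii). -/

/-! ### The `L²` Fourier transform on `L¹ ∩ L²` -/

lemma continuous_fourierInv_of_integrable {g : ℝ → ℂ} (hg : Integrable g) :
    Continuous (𝓕⁻ g : ℝ → ℂ) :=
  VectorFourier.fourierIntegral_continuous Real.continuous_fourierChar
    (L := -innerₗ ℝ) (by
      change Continuous fun p : ℝ × ℝ => -(innerₗ ℝ p.1 p.2)
      exact continuous_inner.neg) hg

lemma integral_fourierInv_smul_eq_of_integrable {f g : ℝ → ℂ} (hf : Integrable f)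
    (hg : Integrable g) :
    ∫ x, (𝓕⁻ f : ℝ → ℂ) x • g x = ∫ x, f x • (𝓕⁻ g : ℝ → ℂ) x := by
  have h := VectorFourier.integral_fourierIntegral_smul_eq_flip (L := -innerₗ ℝ)
    (μ := (volume : Measure ℝ)) (ν := (volume : Measure ℝ)) Real.continuous_fourierChar
    (by
      change Continuous fun p : ℝ × ℝ => -(innerₗ ℝ p.1 p.2)
      exact continuous_inner.neg) hf hg
  have e : (-innerₗ ℝ : ℝ →ₗ[ℝ] ℝ →ₗ[ℝ] ℝ).flip = -innerₗ ℝ := by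
    ext; simp
  rw [e] at h
  exact h

open scoped SchwartzMap in
/-- On `L¹ ∩ L²` the `L²` inverse Fourier transform is given by the integral. -/
theorem fourierInv_toLp_ae_eq {g : ℝ → ℂ} (h1 : Integrable g) (h2 : MemLp g 2 volume) :
    ((𝓕⁻ (h2.toLp g) : L2R) : ℝ → ℂ) =ᵐ[volume] (𝓕⁻ g : ℝ → ℂ) := by
  -- Both sides are locally integrable, so it suffices to test against smooth compactly supported
  -- `φ`. The transform moves onto `φ` by the distributional definition on the `L²` side and by
  -- Fubini on the integral side.
  refine ae_eq_of_integral_contDiff_smul_eq ?_ ?_ ?_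
  · exact (Lp.memLp _).locallyIntegrable (by norm_num)
  · exact (continuous_fourierInv_of_integrable h1).locallyIntegrable
  · intro φ hφ hc
    have hc' : HasCompactSupport (fun x => (φ x : ℂ)) := hc.comp_left (g := Complex.ofReal) rfl
    let Φ : 𝓢(ℝ, ℂ) := hc'.toSchwartzMap (Complex.ofRealCLM.contDiff.comp hφ)
    have hΦ : ∀ x, Φ x = (φ x : ℂ) := fun x => rfl
    have key := congrArg (fun T => T Φ) (Lp.fourierInv_toTemperedDistribution_eq (h2.toLp g))
    simp only [TemperedDistribution.fourierInv_apply, Lp.toTemperedDistribution_apply] at key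
    have e1 : ∫ x, (𝓕⁻ Φ) x • (h2.toLp g : L2R) x = ∫ x, (𝓕⁻ (Φ : ℝ → ℂ) : ℝ → ℂ) x • g x := by
      refine integral_congr_ae ?_
      filter_upwards [h2.coeFn_toLp] with x hx
      rw [hx, SchwartzMap.fourierInv_coe]
    rw [e1, integral_fourierInv_smul_eq_of_integrable Φ.integrable h1] at key
    simpa [hΦ] using key.symm

theorem inner_fourierInv_toLp {f g : ℝ → ℂ} (hf : MemLp f 2 volume) (hg : MemLp g 2 volume) :
    inner ℂ (𝓕⁻ (hf.toLp f) : L2R) (𝓕⁻ (hg.toLp g) : L2R)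
      = ∫ y, g y * (starRingEnd ℂ) (f y) := by
  have h : inner ℂ (𝓕⁻ (hf.toLp f) : L2R) (𝓕⁻ (hg.toLp g) : L2R)
      = inner ℂ (hf.toLp f) (hg.toLp g) :=
    (Lp.fourierTransformₗᵢ ℝ ℂ).symm.inner_map_map _ _
  rw [h, L2.inner_def]
  refine integral_congr_ae ?_
  filter_upwards [hf.coeFn_toLp, hg.coeFn_toLp] with x h1 h2
  rw [h1, h2]
  simp [RCLike.inner_apply]

/-! ### The representation on the Fourier side -/

/-- The Fourier transform of `π(x + is)f`, given the transform `g` of `f`. -/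
def modulatedDilation (x s : ℝ) (g : ℝ → ℂ) (y : ℝ) : ℂ :=
  ((s ^ (1 / 2 : ℝ) : ℝ) : ℂ) * Complex.exp (-(2 * Real.pi * x * y : ℝ) * Complex.I) * g (s * y)

lemma integrable_modulatedDilation {x s : ℝ} (hs : 0 < s) {g : ℝ → ℂ} (hg : Integrable g) :
    Integrable (modulatedDilation x s g) := by
  have h1 : Integrable (fun y => g (s * y)) := hg.comp_mul_left' hs.ne'
  refine (h1.bdd_mul (c := s ^ (1 / 2 : ℝ)) (f := fun y : ℝ => ((s ^ (1 / 2 : ℝ) : ℝ) : ℂ) *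
    Complex.exp (-(2 * Real.pi * x * y : ℝ) * Complex.I)) (by fun_prop) (ae_of_all _ fun y => ?_))
  rw [norm_mul, ← Complex.ofReal_neg, Complex.norm_exp_ofReal_mul_I, mul_one, Complex.norm_real,
    Real.norm_of_nonneg (by positivity)]

lemma memLp_modulatedDilation {x s : ℝ} (hs : 0 < s) {g : ℝ → ℂ} (hg : MemLp g 2 volume) :
    MemLp (modulatedDilation x s g) 2 volume := by
  have h1 : MemLp (fun y => g (s * y)) 2 volume := by
    refine MemLp.comp_of_map (g := g) (f := fun y : ℝ => s * y) ?_ (by fun_prop)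
    rw [Real.map_volume_mul_left hs.ne']
    exact hg.smul_measure ENNReal.ofReal_ne_top
  have h2 : MemLp (fun y => ((s ^ (1 / 2 : ℝ) : ℝ) : ℂ) * g (s * y)) 2 volume := h1.const_mul _
  refine h2.of_le ?_ (ae_of_all _ fun y => ?_)
  · exact (AEStronglyMeasurable.mul (by fun_prop) h1.1)
  · rw [modulatedDilation, norm_mul, norm_mul, norm_mul, ← Complex.ofReal_neg,
      Complex.norm_exp_ofReal_mul_I, mul_one]

/-- Substituting `v = s y` in the integral on the right, the Jacobian `s` turns `s^{-1/2}` into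
`s^{1/2}`, and the shift by `x` splits off as a character. -/
lemma fourierInv_modulatedDilation {x s : ℝ} (hs : 0 < s) (g : ℝ → ℂ) (t : ℝ) :
    (𝓕⁻ (modulatedDilation x s g) : ℝ → ℂ) t
      = ((s ^ (-(1 / 2 : ℝ)) : ℝ) : ℂ) * (𝓕⁻ g : ℝ → ℂ) ((t - x) / s) := by
  rw [Real.fourierInv_eq', Real.fourierInv_eq']
  have h := Measure.integral_comp_mul_left (fun v : ℝ => Complex.exp
    (↑(2 * Real.pi * inner ℝ v ((t - x) / s)) * Complex.I) • g v) s
  have h' : ∫ v : ℝ, Complex.exp (↑(2 * Real.pi * inner ℝ v ((t - x) / s)) * Complex.I) • g v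
      = (s : ℂ) * ∫ y : ℝ, Complex.exp
    (↑(2 * Real.pi * inner ℝ (s * y) ((t - x) / s)) * Complex.I) • g (s * y) := by
    rw [h, abs_of_pos (inv_pos.mpr hs), Complex.real_smul, ← mul_assoc, ← Complex.ofReal_mul,
      mul_inv_cancel₀ hs.ne', Complex.ofReal_one, one_mul]
  rw [h', ← mul_assoc, ← Complex.ofReal_mul, ← integral_const_mul]
  have e : s ^ (-(1 / 2 : ℝ)) * s = s ^ (1 / 2 : ℝ) := by
    nth_rewrite 2 [← Real.rpow_one s]
    rw [← Real.rpow_add hs]; norm_num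
  rw [e]
  congr 1
  funext y
  simp only [modulatedDilation, smul_eq_mul, RCLike.inner_apply, conj_trivial]
  have e2 : Complex.exp (↑(2 * Real.pi * ((t - x) / s * (s * y))) * Complex.I)
      = Complex.exp (↑(2 * Real.pi * (t * y)) * Complex.I) *
        Complex.exp (-(2 * Real.pi * x * y : ℝ) * Complex.I) := by
    rw [← Complex.exp_add]
    congr 1
    have : (t - x) / s * (s * y) = t * y - x * y := by field_simp
    rw [this]; push_cast; ring
  rw [e2]; ring

/-- Integrability of `g` represents both sides almost everywhere by absolutely convergent integrals,
for which the identity is pointwise. Affine maps preserve null sets, so the representation survives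
the substitution `(t - x)/s`. -/
theorem affineAction_fourierInv (z : UpperHalfPlane) {g : ℝ → ℂ} (h1 : Integrable g)
    (h2 : MemLp g 2 volume) :
    affineAction z (𝓕⁻ (h2.toLp g) : L2R)
      = 𝓕⁻ ((memLp_modulatedDilation (x := z.re) z.im_pos h2).toLp _) := by
  apply Lp.ext
  have a1 := (quasiMeasurePreserving_affine z.im_pos.ne' z.re).ae_eq_comp
    (fourierInv_toLp_ae_eq h1 h2)
  filter_upwards [(memLp_affineAction z (𝓕⁻ (h2.toLp g) : L2R)).coeFn_toLp, a1,
    fourierInv_toLp_ae_eq (integrable_modulatedDilation (x := z.re) z.im_pos h1)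
      (memLp_modulatedDilation z.im_pos h2)] with t b1 b2 b3
  rw [affineAction, b1, b3, fourierInv_modulatedDilation z.im_pos]
  simp only [Function.comp] at b2
  rw [b2]

/-! ### The Gamma integral with a complex rate -/

open ProbabilityTheory in
/-- The Gamma integral with a complex rate `r`. -/
theorem integral_rpow_mul_cexp_neg_mul_Ioi {a : ℝ} {r : ℂ} (ha : 0 < a) (hr : 0 < r.re) :
    ∫ t : ℝ in Set.Ioi 0, ((t ^ (a - 1) : ℝ) : ℂ) * Complex.exp (-(r * t))
      = (1 / r) ^ (a : ℂ) * (Real.Gamma a : ℂ) := by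
  -- With the weight `t^{a-1}` absorbed into the measure, the integral becomes a complex moment
  -- generating function at `-r`, analytic for `Re r > 0`. The right side is analytic there too, and
  -- the two agree for real `r`; the identity theorem concludes.
  set μ : Measure ℝ := (volume.restrict (Set.Ioi 0)).withDensity
    fun t => ENNReal.ofReal (t ^ (a - 1)) with hμ
  have hint : ∀ f : ℝ → ℂ, ∫ t, f t ∂μ
      = ∫ t : ℝ in Set.Ioi 0, ((t ^ (a - 1) : ℝ) : ℂ) * f t := by
    intro f
    rw [hμ, integral_withDensity_eq_integral_toReal_smul (by fun_prop) (by simp)]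
    refine setIntegral_congr_fun measurableSet_Ioi fun t ht => ?_
    rw [ENNReal.toReal_ofReal (Real.rpow_nonneg (le_of_lt ht) _), Complex.real_smul]
  have hmgf : ∀ z : ℂ, complexMGF id μ z
      = ∫ t : ℝ in Set.Ioi 0, ((t ^ (a - 1) : ℝ) : ℂ) * Complex.exp (z * t) := by
    intro z; rw [complexMGF, hint]; rfl
  have hset : Set.Iio 0 ⊆ integrableExpSet id μ := by
    intro x hx
    have hx' : 0 < -x := neg_pos.mpr hx
    change Integrable (fun t : ℝ => Real.exp (x * t)) μ
    rw [hμ, integrable_withDensity_iff_integrable_smul' (by fun_prop) (by simp)]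
    have h := integrableOn_rpow_mul_exp_neg_mul_rpow (s := a - 1) (p := 1) (b := -x)
      (by linarith) one_pos hx'
    refine h.congr_fun (fun t ht => ?_) measurableSet_Ioi
    simp only
    rw [ENNReal.toReal_ofReal (Real.rpow_nonneg (le_of_lt ht) _)]
    simp
  have hU : ∀ z : ℂ, z.re < 0 → z.re ∈ interior (integrableExpSet id μ) := fun z hz =>
    interior_maximal hset isOpen_Iio hz
  have hA : AnalyticOnNhd ℂ (complexMGF id μ) {z | z.re < 0} :=
    analyticOnNhd_complexMGF.mono fun z hz => hU z hz
  have hB : AnalyticOnNhd ℂ (fun z : ℂ => (1 / (-z)) ^ (a : ℂ) * (Real.Gamma a : ℂ))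
      {z | z.re < 0} := by
    refine DifferentiableOn.analyticOnNhd ?_ (isOpen_Iio.preimage Complex.continuous_re)
    intro z hz
    have hz' : 0 < (-z).re := by simpa using hz
    have hz0 : -z ≠ 0 := fun h => by rw [h] at hz'; simp at hz'
    have hsl : 1 / -z ∈ Complex.slitPlane := by
      left
      rw [one_div, Complex.inv_re]
      exact div_pos hz' (Complex.normSq_pos.mpr hz0)
    refine DifferentiableAt.differentiableWithinAt ?_
    have hd : DifferentiableAt ℂ (fun w : ℂ => 1 / -w) z :=
      (differentiableAt_const _).div differentiableAt_id.neg hz0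
    exact (hd.cpow_const hsl).mul_const _
  have hreal : ∀ x : ℝ, x < 0 → complexMGF id μ x
      = (1 / (-(x : ℂ))) ^ (a : ℂ) * (Real.Gamma a : ℂ) := by
    intro x hx
    have h := Complex.integral_cpow_mul_exp_neg_mul_Ioi (a := (a : ℂ)) (r := -x) (by simpa using ha)
      (neg_pos.mpr hx)
    rw [hmgf, ← Complex.Gamma_ofReal]
    rw [Complex.ofReal_neg] at h
    rw [← h]
    refine setIntegral_congr_fun measurableSet_Ioi fun t ht => ?_
    rw [Complex.ofReal_cpow (le_of_lt ht)]
    simp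
  have hconn : IsPreconnected {z : ℂ | z.re < 0} := (convex_halfSpace_re_lt 0).isPreconnected
  -- Real points accumulate at `-1`, which is all that the identity theorem needs.
  have hfreq : ∃ᶠ z in nhdsWithin (-1 : ℂ) {-1}ᶜ, complexMGF id μ z
      = (fun z : ℂ => (1 / (-z)) ^ (a : ℂ) * (Real.Gamma a : ℂ)) z := by
    have ht : Filter.Tendsto (fun x : ℝ => (x : ℂ)) (nhdsWithin (-1 : ℝ) {-1}ᶜ)
        (nhdsWithin (-1 : ℂ) {-1}ᶜ) := by
      refine tendsto_nhdsWithin_iff.mpr ⟨?_, ?_⟩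
      · have := (Complex.continuous_ofReal.tendsto (-1 : ℝ))
        simp only [Complex.ofReal_neg, Complex.ofReal_one] at this
        exact this.mono_left nhdsWithin_le_nhds
      · filter_upwards [self_mem_nhdsWithin] with x hx
        simpa [← Complex.ofReal_one, ← Complex.ofReal_neg, Complex.ofReal_inj] using hx
    refine ht.frequently (Filter.Eventually.frequently ?_)
    have : ∀ᶠ x : ℝ in nhds (-1 : ℝ), x < 0 := eventually_lt_nhds (by norm_num)
    exact (this.filter_mono nhdsWithin_le_nhds).mono hreal
  have := hA.eqOn_of_preconnected_of_frequently_eq hB hconn (by simp) hfreq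
    (show -r ∈ {z : ℂ | z.re < 0} by simpa using hr)
  rw [hmgf] at this
  simpa using this

/-! ### Closed form of the wavelet transform -/

/-- The function `t^b e^{-t}` on the positive half-line, extended by zero. -/
def powExp (b t : ℝ) : ℝ := if 0 < t then t ^ b * Real.exp (-t) else 0

/-- `powExp`, in Mathlib's normalization of the frequency variable. -/
def powExpFreq (b y : ℝ) : ℂ := (powExp b (2 * Real.pi * y) : ℝ)

lemma memLp_powExpFreq {b : ℝ} (hb : 0 < b) : MemLp (powExpFreq b) 2 volume := by
  refine MemLp.ofReal ?_
  refine MemLp.comp_of_map (g := powExp b) (f := fun y : ℝ => 2 * Real.pi * y) ?_ (by fun_prop)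
  rw [Real.map_volume_mul_left (by positivity)]
  exact (memLp_rpow_mul_exp hb).smul_measure ENNReal.ofReal_ne_top

lemma integrable_powExpFreq {b : ℝ} (hb : 0 < b) : Integrable (powExpFreq b) := by
  refine Integrable.ofReal ?_
  have h : Integrable (powExp b) := by
    have h := Real.GammaIntegral_convergent (s := b + 1) (by linarith)
    rw [← integrable_indicator_iff measurableSet_Ioi] at h
    refine h.congr (Filter.Eventually.of_forall fun t => ?_)
    by_cases ht : 0 < t
    · simp [Set.indicator, ht, powExp, mul_comm]
    · simp [Set.indicator, ht, powExp]
  exact h.comp_mul_left' (by positivity)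

/-- The coefficients of `psiHat` with respect to the functions `powExp`. -/
def psiCoeff (n : ℕ) (α : ℝ) (k : ℕ) : ℝ :=
  Real.sqrt (2 ^ (α + 2) * Real.pi * n.factorial / Real.Gamma (n + α + 1)) *
    ((-1) ^ k / (k.factorial : ℝ) * Ring.choose ((n : ℝ) + α) (n - k) * 2 ^ k)

lemma psiHat_eq_sum_powExp (n : ℕ) (α t : ℝ) :
    psiHat n α t = ∑ k ∈ Finset.range (n + 1), psiCoeff n α k * powExp (α / 2 + k) t := by
  by_cases ht : 0 < t
  · simp only [psiHat, powExp, psiCoeff, ht, if_true, laguerreGen, Finset.mul_sum]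
    refine Finset.sum_congr rfl fun k _ => ?_
    rw [Real.rpow_add ht, Real.rpow_natCast, mul_pow]
    ring
  · simp [psiHat, powExp, ht]

lemma psiHat_scaled_eq_sum (n : ℕ) (α y : ℝ) :
    ((psiHat n α (2 * Real.pi * y) : ℝ) : ℂ)
      = ∑ k ∈ Finset.range (n + 1), (psiCoeff n α k : ℂ) * powExpFreq (α / 2 + k) y := by
  rw [psiHat_eq_sum_powExp]
  push_cast
  rfl

lemma integrable_psiHat_scaled (n : ℕ) {α : ℝ} (hα : 0 < α) :
    Integrable (fun y : ℝ => ((psiHat n α (2 * Real.pi * y) : ℝ) : ℂ)) := by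
  simp_rw [psiHat_scaled_eq_sum]
  exact integrable_finsetSum _ fun k _ => (integrable_powExpFreq (by positivity)).const_mul _

theorem waveletTransform_psi (n : ℕ) {α : ℝ} (hα : 0 < α) (z : UpperHalfPlane) :
    waveletTransform (psi n α hα) (psi n α hα) z
      = ∫ y : ℝ, ((psiHat n α (2 * Real.pi * y) : ℝ) : ℂ) * (starRingEnd ℂ)
        (modulatedDilation z.re z.im (fun y => ((psiHat n α (2 * Real.pi * y) : ℝ) : ℂ)) y) := by
  change inner ℂ (affineAction z (psiL2 n α hα)) (psiL2 n α hα) = _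
  rw [psiL2, affineAction_fourierInv z (integrable_psiHat_scaled n hα),
    inner_fourierInv_toLp]

/-- `1 + s - ix` for the point `z = x + is`. -/
def cayleyDenom (z : UpperHalfPlane) : ℂ := 1 + z.im - z.re * Complex.I

lemma cayleyDenom_re (z : UpperHalfPlane) : (cayleyDenom z).re = 1 + z.im := by
  simp [cayleyDenom]

/-- The wavelet transform of the function with transform `powExp b`, relative to the one with
transform `powExp c`. -/
theorem integral_powExpFreq_mul_modulatedDilation {b c : ℝ} (hb : 0 < b) (hc : 0 < c)
    (z : UpperHalfPlane) :
    ∫ y : ℝ, powExpFreq b y * (starRingEnd ℂ) (modulatedDilation z.re z.im (powExpFreq c) y)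
      = ((z.im ^ (1 / 2 + c) * Real.Gamma (b + c + 1) / (2 * Real.pi) : ℝ) : ℂ) *
        (1 / cayleyDenom z) ^ ((b + c + 1 : ℝ) : ℂ) := by
  have hs := z.im_pos
  have hπ : 0 < 2 * Real.pi := by positivity
  have h := integral_rpow_mul_cexp_neg_mul_Ioi (a := b + c + 1) (r := cayleyDenom z)
    (by positivity) (by rw [cayleyDenom_re]; positivity)
  -- In the variable `t = 2πy`, the factors `e^{-t}`, `e^{-st}` and the conjugated character
  -- `e^{ixt}` combine to `e^{-(1+s-ix)t}`. As `s > 0`, the two cutoffs coincide. The Jacobian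
  -- supplies the factor `1/(2π)`.
  let F : ℝ → ℂ := fun t => ((z.im ^ (1 / 2 + c) : ℝ) : ℂ) *
    (Set.Ioi (0 : ℝ)).indicator (fun t : ℝ =>
      ((t ^ (b + c + 1 - 1) : ℝ) : ℂ) * Complex.exp (-(cayleyDenom z * t))) t
  have e : ∀ y : ℝ, powExpFreq b y * (starRingEnd ℂ)
      (modulatedDilation z.re z.im (powExpFreq c) y) = F (2 * Real.pi * y) := by
    intro y
    simp only [F, powExpFreq, powExp, modulatedDilation]
    by_cases hy : 0 < 2 * Real.pi * y
    · have hy' : 0 < 2 * Real.pi * (z.im * y) := by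
        rw [show 2 * Real.pi * (z.im * y) = z.im * (2 * Real.pi * y) by ring]; positivity
      rw [if_pos hy, if_pos hy', Set.indicator_of_mem (Set.mem_Ioi.mpr hy)]
      rw [show 2 * Real.pi * (z.im * y) = z.im * (2 * Real.pi * y) by ring,
        Real.mul_rpow hs.le hy.le, add_sub_cancel_right, Real.rpow_add hs, Real.rpow_add hy]
      have e1 : Complex.exp (-(cayleyDenom z * ((2 * Real.pi * y : ℝ) : ℂ)))
          = Complex.exp ((-(2 * Real.pi * y) : ℝ)) *
            Complex.exp ((-(z.im * (2 * Real.pi * y)) : ℝ)) *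
            Complex.exp ((2 * Real.pi * z.re * y : ℝ) * Complex.I) := by
        rw [← Complex.exp_add, ← Complex.exp_add, cayleyDenom]
        congr 1
        push_cast; ring
      have e2 : (starRingEnd ℂ) (Complex.exp (-((2 * Real.pi * z.re * y : ℝ) : ℂ) * Complex.I))
          = Complex.exp ((2 * Real.pi * z.re * y : ℝ) * Complex.I) := by
        rw [← Complex.exp_conj]
        congr 1
        rw [map_mul, map_neg, Complex.conj_ofReal, Complex.conj_I, neg_mul_neg]
      rw [e1, map_mul, map_mul, e2, Complex.conj_ofReal, Complex.conj_ofReal]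
      push_cast
      ring
    · rw [if_neg hy, Set.indicator_of_notMem (by simpa using hy)]
      simp
  rw [integral_congr_ae (ae_of_all _ e), Measure.integral_comp_mul_left F, integral_const_mul, integral_indicator measurableSet_Ioi, h,
    abs_of_pos (inv_pos.mpr hπ), Complex.real_smul]
  push_cast
  field_simp

theorem waveletTransform_psi_eq_sum (n : ℕ) {α : ℝ} (hα : 0 < α) (z : UpperHalfPlane) :
    waveletTransform (psi n α hα) (psi n α hα) z
      = ∑ j ∈ Finset.range (n + 1), ∑ k ∈ Finset.range (n + 1),
        ((psiCoeff n α j * psiCoeff n α k * (z.im ^ (1 / 2 + (α / 2 + k)) *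
          Real.Gamma (α / 2 + j + (α / 2 + k) + 1) / (2 * Real.pi)) : ℝ) : ℂ) *
        (1 / cayleyDenom z) ^ ((α / 2 + j + (α / 2 + k) + 1 : ℝ) : ℂ) := by
  have hpos : ∀ k : ℕ, 0 < α / 2 + k := fun k => by positivity
  rw [waveletTransform_psi]
  have e : ∀ y : ℝ, ((psiHat n α (2 * Real.pi * y) : ℝ) : ℂ) * (starRingEnd ℂ)
      (modulatedDilation z.re z.im (fun y => ((psiHat n α (2 * Real.pi * y) : ℝ) : ℂ)) y)
      = ∑ j ∈ Finset.range (n + 1), ∑ k ∈ Finset.range (n + 1),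
        ((psiCoeff n α j * psiCoeff n α k : ℝ) : ℂ) * (powExpFreq (α / 2 + j) y * (starRingEnd ℂ)
          (modulatedDilation z.re z.im (powExpFreq (α / 2 + k)) y)) := by
    intro y
    rw [modulatedDilation, psiHat_scaled_eq_sum, psiHat_scaled_eq_sum, Finset.mul_sum, map_sum,
      Finset.sum_mul_sum]
    refine Finset.sum_congr rfl fun j _ => Finset.sum_congr rfl fun k _ => ?_
    simp only [modulatedDilation, map_mul, Complex.conj_ofReal]
    push_cast; ring
  have hint : ∀ j k : ℕ, Integrable fun y =>
      ((psiCoeff n α j * psiCoeff n α k : ℝ) : ℂ) * (powExpFreq (α / 2 + j) y * (starRingEnd ℂ)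
          (modulatedDilation z.re z.im (powExpFreq (α / 2 + k)) y)) := fun j k =>
    ((memLp_powExpFreq (hpos j)).integrable_mul
      (memLp_modulatedDilation z.im_pos (memLp_powExpFreq (hpos k))).star).const_mul _
  simp_rw [e]
  rw [integral_finsetSum _ fun j _ => integrable_finsetSum _ fun k _ => hint j k]
  refine Finset.sum_congr rfl fun j _ => ?_
  rw [integral_finsetSum _ fun k _ => hint j k]
  refine Finset.sum_congr rfl fun k _ => ?_
  rw [integral_const_mul, integral_powExpFreq_mul_modulatedDilation (hpos j) (hpos k)]
  push_cast; ring

/-! ### Integrals over the hyperbolic half-plane -/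

/-- This identifies `volume` on `UpperHalfPlane` with `μ⁺`. Extending the integrand by zero to `ℝ ×
ℝ` makes Tonelli available. -/
theorem lintegral_upperHalfPlane {F : ℝ → ℝ → ℝ≥0∞} (hF : Measurable (Function.uncurry F)) :
    ∫⁻ z : UpperHalfPlane, F z.re z.im
      = ∫⁻ s in Set.Ioi (0 : ℝ), ∫⁻ x, ENNReal.ofReal (s ^ (-2 : ℝ)) * F x s := by
  let H : ℝ × ℝ → ℝ≥0∞ := (Set.univ ×ˢ Set.Ioi (0 : ℝ)).indicator
    fun p => ENNReal.ofReal (p.2 ^ (-2 : ℝ)) * F p.1 p.2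
  have hH : Measurable H := by
    refine Measurable.indicator ?_ (MeasurableSet.univ.prod measurableSet_Ioi)
    exact Measurable.mul (by fun_prop) hF
  have hz : ∀ z : UpperHalfPlane,
      (((1 / NNReal.mk z.im z.im_pos.le : NNReal) ^ 2 : NNReal) : ℝ≥0∞) * F z.re z.im
        = H (Complex.measurableEquivRealProd (z : ℂ)) := by
    intro z
    have hmem : Complex.measurableEquivRealProd (z : ℂ) ∈ Set.univ ×ˢ Set.Ioi (0 : ℝ) :=
      ⟨trivial, z.im_pos⟩
    simp only [H]
    rw [Set.indicator_of_mem hmem]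
    change _ = ENNReal.ofReal (z.im ^ (-2 : ℝ)) * F z.re z.im
    congr 1
    rw [ENNReal.ofReal, ENNReal.coe_inj]
    ext
    rw [Real.coe_toNNReal _ (Real.rpow_nonneg z.im_pos.le _), Real.rpow_neg z.im_pos.le]
    norm_num
  rw [UpperHalfPlane.volume_def, lintegral_withDensity_eq_lintegral_mul_non_measurable]
  rotate_left
  · have : Measurable fun z : UpperHalfPlane => z.im :=
      Complex.measurable_im.comp UpperHalfPlane.measurable_coe
    refine measurable_coe_nnreal_ennreal.comp (Measurable.pow_const ?_ 2)
    exact measurable_const.div (this.subtype_mk)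
  · exact ae_of_all _ fun z => ENNReal.coe_lt_top
  simp only [Pi.mul_apply]
  rw [lintegral_congr hz]
  have hmp : MeasurePreserving UpperHalfPlane.coe (volume.comap UpperHalfPlane.coe)
      (volume.restrict (.range UpperHalfPlane.coe)) :=
    ⟨UpperHalfPlane.measurable_coe, by rw [UpperHalfPlane.measurableEmbedding_coe.map_comap]⟩
  rw [hmp.lintegral_comp_emb UpperHalfPlane.measurableEmbedding_coe
    (fun w => H (Complex.measurableEquivRealProd w)),
    ← lintegral_indicator UpperHalfPlane.measurableEmbedding_coe.measurableSet_range]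
  have hind : (Set.range UpperHalfPlane.coe).indicator
      (fun w => H (Complex.measurableEquivRealProd w))
      = fun w => H (Complex.measurableEquivRealProd w) := by
    rw [Set.indicator_eq_self]
    intro w hw
    by_contra hr
    apply hw
    refine Set.indicator_of_notMem ?_ _
    rintro ⟨-, h⟩
    exact hr ⟨⟨w, h⟩, rfl⟩
  rw [hind, Complex.volume_preserving_equiv_real_prod.lintegral_comp hH, Measure.volume_eq_prod,
    lintegral_prod_symm _ hH.aemeasurable, ← lintegral_indicator measurableSet_Ioi]
  refine lintegral_congr fun s => ?_
  by_cases hs : s ∈ Set.Ioi (0 : ℝ)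
  · simp [H, Set.indicator, Set.mem_Ioi.mp hs]
  · simp [H, Set.indicator, show ¬ 0 < s from hs]

lemma lintegral_rpow_mul_exp_neg_mul_Ioi {a r : ℝ} (ha : 0 < a) (hr : 0 < r) :
    ∫⁻ t in Set.Ioi (0 : ℝ), ENNReal.ofReal (t ^ (a - 1) * Real.exp (-(r * t)))
      = ENNReal.ofReal (r ^ (-a) * Real.Gamma a) := by
  rw [← ofReal_integral_eq_lintegral_ofReal, Real.integral_rpow_mul_exp_neg_mul_Ioi ha hr,
    one_div, Real.inv_rpow hr.le, Real.rpow_neg hr.le]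
  · have h := integrableOn_rpow_mul_exp_neg_mul_rpow (s := a - 1) (p := 1) (b := r)
      (by linarith) one_pos hr
    simpa [IntegrableOn] using h
  · filter_upwards [ae_restrict_mem measurableSet_Ioi] with t ht
    have : (0 : ℝ) < t := ht
    simp only [Pi.zero_apply]
    positivity

/-- Writing `(c² + x²)^{-q}` as a Gamma integral in `u` and applying Tonelli leaves a Gaussian in
`x`. Its value `√(π/u)` lowers the Gamma exponent to `q - 1/2`, whence the condition on `q`. -/
lemma lintegral_sq_add_sq_rpow_neg {q c : ℝ} (hq : 1 / 2 < q) (hc : 0 < c) :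
    ∫⁻ x : ℝ, ENNReal.ofReal ((c ^ 2 + x ^ 2) ^ (-q))
      = ENNReal.ofReal (Real.sqrt Real.pi * Real.Gamma (q - 1 / 2) / Real.Gamma q
        * c ^ (1 - 2 * q)) := by
  have hΓ : 0 < Real.Gamma q := Real.Gamma_pos_of_pos (by linarith)
  have h1 : ∀ x : ℝ, ENNReal.ofReal ((c ^ 2 + x ^ 2) ^ (-q)) = ENNReal.ofReal (Real.Gamma q)⁻¹ *
      ∫⁻ u in Set.Ioi (0 : ℝ), ENNReal.ofReal (u ^ (q - 1) * Real.exp (-((c ^ 2 + x ^ 2) * u))) := by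
    intro x
    rw [lintegral_rpow_mul_exp_neg_mul_Ioi (by linarith) (by positivity),
      ← ENNReal.ofReal_mul (by positivity)]
    congr 1
    field_simp
  have h2 : ∀ u ∈ Set.Ioi (0 : ℝ),
      ∫⁻ x : ℝ, ENNReal.ofReal (u ^ (q - 1) * Real.exp (-((c ^ 2 + x ^ 2) * u)))
      = ENNReal.ofReal (Real.sqrt Real.pi) *
        ENNReal.ofReal (u ^ (q - 1 / 2 - 1) * Real.exp (-(c ^ 2 * u))) := by
    intro u hu
    have hu : 0 < u := hu
    have e : ∀ x : ℝ, u ^ (q - 1) * Real.exp (-((c ^ 2 + x ^ 2) * u))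
        = (u ^ (q - 1) * Real.exp (-(c ^ 2 * u))) * Real.exp (-u * x ^ 2) := by
      intro x
      rw [mul_assoc, ← Real.exp_add]; congr 2; ring
    simp_rw [e]
    rw [← ofReal_integral_eq_lintegral_ofReal ((integrable_exp_neg_mul_sq hu).const_mul _)
      (ae_of_all _ fun x => by positivity), integral_const_mul, integral_gaussian,
      ← ENNReal.ofReal_mul (by positivity)]
    congr 1
    have e3 : u ^ (q - 1) = u ^ (q - 1 / 2 - 1) * Real.sqrt u := by
      rw [Real.sqrt_eq_rpow, ← Real.rpow_add hu]; congr 1; ring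
    rw [Real.sqrt_div Real.pi_pos.le, e3]
    have : 0 < Real.sqrt u := Real.sqrt_pos.mpr hu
    field_simp
  simp_rw [h1]
  rw [lintegral_const_mul' _ _ ENNReal.ofReal_ne_top, lintegral_lintegral_swap (by fun_prop),
    setLIntegral_congr_fun measurableSet_Ioi h2, lintegral_const_mul' _ _ ENNReal.ofReal_ne_top,
    lintegral_rpow_mul_exp_neg_mul_Ioi (by linarith) (by positivity),
    ← ENNReal.ofReal_mul (by positivity), ← ENNReal.ofReal_mul (by positivity)]
  congr 1
  have e4 : (c ^ 2) ^ (-(q - 1 / 2)) = c ^ (1 - 2 * q) := by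
    rw [← Real.rpow_natCast, ← Real.rpow_mul hc.le]; congr 1; push_cast; ring
  rw [e4]
  field_simp

/-- Euler's Beta integral on the half-line. -/
lemma lintegral_rpow_mul_one_add_rpow_neg {a b : ℝ} (ha : 0 < a) (hb : 0 < b) :
    ∫⁻ s in Set.Ioi (0 : ℝ), ENNReal.ofReal (s ^ (a - 1) * (1 + s) ^ (-(a + b)))
      = ENNReal.ofReal (Real.Gamma a * Real.Gamma b / Real.Gamma (a + b)) := by
  have hΓ : 0 < Real.Gamma (a + b) := Real.Gamma_pos_of_pos (by linarith)
  have hΓa : 0 < Real.Gamma a := Real.Gamma_pos_of_pos ha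
  -- The same device: `(1 + s)^{-(a+b)}` becomes a Gamma integral in `u`, and after the swap both
  -- the `s`- and the `u`-integral are Gamma integrals.
  have h1 : ∀ s ∈ Set.Ioi (0 : ℝ), ENNReal.ofReal (s ^ (a - 1) * (1 + s) ^ (-(a + b)))
      = ENNReal.ofReal (Real.Gamma (a + b))⁻¹ * ∫⁻ u in Set.Ioi (0 : ℝ),
        ENNReal.ofReal (s ^ (a - 1) * (u ^ (a + b - 1) * Real.exp (-((1 + s) * u)))) := by
    intro s hs
    have hs : 0 < s := hs
    simp_rw [ENNReal.ofReal_mul (Real.rpow_nonneg hs.le (a - 1))]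
    rw [lintegral_const_mul' _ _ ENNReal.ofReal_ne_top,
      lintegral_rpow_mul_exp_neg_mul_Ioi (by linarith) (by positivity),
      ← ENNReal.ofReal_mul (by positivity), ← ENNReal.ofReal_mul (by positivity),
      ← ENNReal.ofReal_mul (by positivity)]
    congr 1
    field_simp
  have h2 : ∀ u ∈ Set.Ioi (0 : ℝ), ∫⁻ s in Set.Ioi (0 : ℝ),
        ENNReal.ofReal (s ^ (a - 1) * (u ^ (a + b - 1) * Real.exp (-((1 + s) * u))))
      = ENNReal.ofReal (Real.Gamma a) * ENNReal.ofReal (u ^ (b - 1) * Real.exp (-(1 * u))) := by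
    intro u hu
    have hu : 0 < u := hu
    have e : ∀ s : ℝ, s ^ (a - 1) * (u ^ (a + b - 1) * Real.exp (-((1 + s) * u)))
        = (u ^ (a + b - 1) * Real.exp (-(1 * u))) * (s ^ (a - 1) * Real.exp (-(u * s))) := by
      intro s
      have : Real.exp (-((1 + s) * u)) = Real.exp (-(1 * u)) * Real.exp (-(u * s)) := by
        rw [← Real.exp_add]; congr 1; ring
      rw [this]; ring
    have hpos : 0 ≤ u ^ (a + b - 1) * Real.exp (-(1 * u)) := by positivity
    simp_rw [e, ENNReal.ofReal_mul hpos]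
    rw [lintegral_const_mul' _ _ ENNReal.ofReal_ne_top, lintegral_rpow_mul_exp_neg_mul_Ioi ha hu,
      ← ENNReal.ofReal_mul (by positivity), ← ENNReal.ofReal_mul (by positivity)]
    congr 1
    have e3 : u ^ (b - 1) = u ^ (a + b - 1) * u ^ (-a) := by
      rw [← Real.rpow_add hu]; congr 1; ring
    rw [e3]; ring
  rw [setLIntegral_congr_fun measurableSet_Ioi h1,
    lintegral_const_mul' _ _ ENNReal.ofReal_ne_top, lintegral_lintegral_swap (by fun_prop),
    setLIntegral_congr_fun measurableSet_Ioi h2, lintegral_const_mul' _ _ ENNReal.ofReal_ne_top,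
    lintegral_rpow_mul_exp_neg_mul_Ioi hb one_pos,
    ← ENNReal.ofReal_mul (by positivity), ← ENNReal.ofReal_mul (by positivity)]
  congr 1
  rw [Real.one_rpow]
  field_simp

/-- Integrating in `x` with `c = 1 + s` leaves `s^{q-2} (1 + s)^{1-2q}`, a Beta integrand with
parameters `q - 1` and `q`; the first is positive exactly when `q > 1`. -/
theorem lintegral_poissonKernel_rpow {q : ℝ} (hq : 1 < q) :
    ∫⁻ z : UpperHalfPlane, ENNReal.ofReal ((4 * z.im) ^ q *
        ((1 + z.im) ^ 2 + z.re ^ 2) ^ (-q))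
      = ENNReal.ofReal (4 * Real.pi / (q - 1)) := by
  have hΓq : 0 < Real.Gamma q := Real.Gamma_pos_of_pos (by linarith)
  have hΓh : 0 < Real.Gamma (q - 1 / 2) := Real.Gamma_pos_of_pos (by linarith)
  have hΓ1 : 0 < Real.Gamma (q - 1) := Real.Gamma_pos_of_pos (by linarith)
  have hΓs : 0 < Real.Gamma (q - 1 + q) := Real.Gamma_pos_of_pos (by linarith)
  rw [lintegral_upperHalfPlane (F := fun x s => ENNReal.ofReal ((4 * s) ^ q *
    ((1 + s) ^ 2 + x ^ 2) ^ (-q))) (by fun_prop)]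
  have h : ∀ s ∈ Set.Ioi (0 : ℝ), ∫⁻ x : ℝ, ENNReal.ofReal (s ^ (-2 : ℝ)) *
      ENNReal.ofReal ((4 * s) ^ q * ((1 + s) ^ 2 + x ^ 2) ^ (-q))
      = ENNReal.ofReal (4 ^ q * (Real.sqrt Real.pi * Real.Gamma (q - 1 / 2) / Real.Gamma q)) *
        ENNReal.ofReal (s ^ (q - 1 - 1) * (1 + s) ^ (-(q - 1 + q))) := by
    intro s hs
    have hs : 0 < s := hs
    have h4 : 0 ≤ (4 * s) ^ q := by positivity
    simp_rw [ENNReal.ofReal_mul h4]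
    rw [lintegral_const_mul' _ _ ENNReal.ofReal_ne_top,
      lintegral_const_mul' _ _ ENNReal.ofReal_ne_top,
      lintegral_sq_add_sq_rpow_neg (by linarith) (by positivity),
      ← ENNReal.ofReal_mul (by positivity), ← ENNReal.ofReal_mul (by positivity),
      ← ENNReal.ofReal_mul (by positivity)]
    congr 1
    have e1 : s ^ (q - 1 - 1) = s ^ (-2 : ℝ) * s ^ q := by
      rw [← Real.rpow_add hs]; congr 1; ring
    have e2 : -(q - 1 + q) = 1 - 2 * q := by ring
    rw [e1, e2, Real.mul_rpow (by norm_num) hs.le]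
    ring
  rw [setLIntegral_congr_fun measurableSet_Ioi h, lintegral_const_mul' _ _ ENNReal.ofReal_ne_top,
    lintegral_rpow_mul_one_add_rpow_neg (by linarith) (by linarith),
    ← ENNReal.ofReal_mul (by positivity)]
  congr 1
  -- Duplication at `q - 1/2` cancels `Γ(2q - 1)`, and `Γ(q) = (q - 1)Γ(q - 1)` leaves the factor
  -- `1/(q - 1)`.
  have hdup := Real.Gamma_mul_Gamma_add_half (q - 1 / 2)
  have hrec := Real.Gamma_add_one (s := q - 1) (by linarith)
  have e1 : q - 1 / 2 + 1 / 2 = q := by ring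
  have e2 : 2 * (q - 1 / 2) = q - 1 + q := by ring
  rw [e1, e2] at hdup
  rw [sub_add_cancel] at hrec
  have e3 : (4 : ℝ) ^ q * 2 ^ (1 - (q - 1 + q)) = 4 := by
    rw [show (4 : ℝ) = 2 ^ (2 : ℝ) by norm_num, ← Real.rpow_mul (by norm_num),
      ← Real.rpow_add (by norm_num)]
    congr 1; ring
  have hπ : Real.sqrt Real.pi * Real.sqrt Real.pi = Real.pi := Real.mul_self_sqrt Real.pi_pos.le
  have hq1 : q - 1 ≠ 0 := by linarith
  calc 4 ^ q * (Real.sqrt Real.pi * Real.Gamma (q - 1 / 2) / Real.Gamma q) *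
        (Real.Gamma (q - 1) * Real.Gamma q / Real.Gamma (q - 1 + q))
      = 4 ^ q * Real.sqrt Real.pi * (Real.Gamma (q - 1 / 2) * Real.Gamma q) * Real.Gamma (q - 1) /
        (Real.Gamma q * Real.Gamma (q - 1 + q)) := by field_simp
    _ = (4 ^ q * 2 ^ (1 - (q - 1 + q))) * (Real.sqrt Real.pi * Real.sqrt Real.pi) *
        Real.Gamma (q - 1) * Real.Gamma (q - 1 + q) /
        (Real.Gamma q * Real.Gamma (q - 1 + q)) := by rw [hdup]; ring
    _ = 4 * Real.pi / (q - 1) := by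
      rw [e3, hπ, hrec]
      field_simp

/-! ### Powers of the kernel and the size of the wavelet transform -/

/-- `(4s)^q |1 + s - ix|^{-2q}` at the point `z = x + is`. -/
def poissonPower (q : ℝ) (z : UpperHalfPlane) : ℝ :=
  (4 * z.im) ^ q * ((1 + z.im) ^ 2 + z.re ^ 2) ^ (-q)

lemma poissonPower_nonneg (q : ℝ) (z : UpperHalfPlane) : 0 ≤ poissonPower q z := by
  have := z.im_pos
  unfold poissonPower
  positivity

lemma poissonPower_rpow (q p : ℝ) (z : UpperHalfPlane) :
    poissonPower q z ^ p = poissonPower (q * p) z := by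
  have := z.im_pos
  unfold poissonPower
  rw [Real.mul_rpow (by positivity) (by positivity), ← Real.rpow_mul (by positivity),
    ← Real.rpow_mul (by positivity), neg_mul]

lemma measurable_upperHalfPlane_re : Measurable fun z : UpperHalfPlane => z.re :=
  Complex.measurable_re.comp UpperHalfPlane.measurable_coe

lemma measurable_upperHalfPlane_im : Measurable fun z : UpperHalfPlane => z.im :=
  Complex.measurable_im.comp UpperHalfPlane.measurable_coe

lemma measurable_poissonPower (q : ℝ) : Measurable (poissonPower q) := by
  have h1 := measurable_upperHalfPlane_re
  have h2 := measurable_upperHalfPlane_im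
  unfold poissonPower
  fun_prop

theorem integrable_poissonPower {q : ℝ} (hq : 1 < q) : Integrable (poissonPower q) := by
  refine ⟨(measurable_poissonPower q).aestronglyMeasurable, ?_⟩
  rw [hasFiniteIntegral_iff_ofReal (ae_of_all _ (poissonPower_nonneg q))]
  exact (lintegral_poissonKernel_rpow hq).trans_lt ENNReal.ofReal_lt_top

theorem integral_poissonPower {q : ℝ} (hq : 1 < q) :
    ∫ z : UpperHalfPlane, poissonPower q z = 4 * Real.pi / (q - 1) := by
  rw [integral_eq_lintegral_of_nonneg_ae (ae_of_all _ (poissonPower_nonneg q))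
    (measurable_poissonPower q).aestronglyMeasurable]
  refine (congrArg ENNReal.toReal (lintegral_poissonKernel_rpow hq)).trans ?_
  have : 0 < q - 1 := by linarith
  exact ENNReal.toReal_ofReal (by positivity)

lemma norm_cayleyDenom_sq (z : UpperHalfPlane) :
    ‖cayleyDenom z‖ ^ 2 = (1 + z.im) ^ 2 + z.re ^ 2 := by
  rw [← Complex.normSq_eq_norm_sq, Complex.normSq_apply]
  simp [cayleyDenom]
  ring

lemma one_add_im_le_norm_cayleyDenom (z : UpperHalfPlane) : 1 + z.im ≤ ‖cayleyDenom z‖ := by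
  rw [← cayleyDenom_re]
  exact Complex.re_le_norm _

lemma norm_cayleyDenom_pos (z : UpperHalfPlane) : 0 < ‖cayleyDenom z‖ :=
  lt_of_lt_of_le (by linarith [z.im_pos]) (one_add_im_le_norm_cayleyDenom z)

lemma norm_one_div_cayleyDenom_cpow (z : UpperHalfPlane) (a : ℝ) :
    ‖(1 / cayleyDenom z) ^ (a : ℂ)‖ = ‖cayleyDenom z‖ ^ (-a) := by
  rw [Complex.norm_cpow_real, norm_div, norm_one, one_div, Real.inv_rpow (norm_nonneg _),
    Real.rpow_neg (norm_nonneg _)]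

lemma poissonPower_eq_norm (α : ℝ) (z : UpperHalfPlane) :
    poissonPower ((α + 1) / 2) z
      = 2 ^ (α + 1) * (z.im ^ (1 / 2 + α / 2) * ‖cayleyDenom z‖ ^ (-(α + 1))) := by
  have hs := z.im_pos
  have hd := norm_cayleyDenom_pos z
  have e1 : 2 * ((α + 1) / 2) = α + 1 := by ring
  have e2 : ((2 : ℕ) : ℝ) * -((α + 1) / 2) = -(α + 1) := by push_cast; ring
  have e3 : 1 / 2 + α / 2 = (α + 1) / 2 := by ring
  rw [poissonPower, ← norm_cayleyDenom_sq, Real.mul_rpow (by norm_num) hs.le,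
    ← Real.rpow_natCast ‖cayleyDenom z‖, ← Real.rpow_mul hd.le,
    show (4 : ℝ) = 2 ^ (2 : ℝ) by norm_num, ← Real.rpow_mul (by norm_num), mul_assoc, e1, e2, e3]

/-- Measurability is read off the closed form, so no continuity of `π` is needed. -/
theorem measurable_waveletTransform_psi (n : ℕ) {α : ℝ} (hα : 0 < α) :
    Measurable (waveletTransform (psi n α hα) (psi n α hα)) := by
  have h1 := measurable_upperHalfPlane_re
  have h2 := measurable_upperHalfPlane_im
  have h3 : Measurable cayleyDenom := by
    unfold cayleyDenom
    fun_prop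
  rw [funext (waveletTransform_psi_eq_sum n hα)]
  fun_prop

/-- The squared normalization `2^{α+2} π / Γ(α+1)` cancels the factor `Γ(α+1)/(2π)` of the Gamma
integral up to `2^{α+1} = 4^{(α+1)/2}`, the constant in `poissonPower`. -/
theorem norm_waveletTransform_psi_zero {α : ℝ} (hα : 0 < α) (z : UpperHalfPlane) :
    ‖waveletTransform (psi 0 α hα) (psi 0 α hα) z‖ = poissonPower ((α + 1) / 2) z := by
  have hs := z.im_pos
  have hΓ : 0 < Real.Gamma (α + 1) := Real.Gamma_pos_of_pos (by linarith)
  have hsq : psiCoeff 0 α 0 * psiCoeff 0 α 0 = 2 ^ (α + 2) * Real.pi / Real.Gamma (α + 1) := by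
    have h : (0 : ℝ) ≤ 2 ^ (α + 2) * Real.pi / Real.Gamma (α + 1) := by positivity
    simp [psiCoeff, -Real.sqrt_div']
    exact Real.mul_self_sqrt h
  rw [waveletTransform_psi_eq_sum]
  simp only [zero_add, Finset.range_one, Finset.sum_singleton, Nat.cast_zero, add_zero, add_halves]
  rw [norm_mul, Complex.norm_real, norm_one_div_cayleyDenom_cpow, hsq,
    Real.norm_of_nonneg (by positivity), poissonPower_eq_norm]
  have e : (2 : ℝ) ^ (α + 2) = 2 * 2 ^ (α + 1) := by
    rw [show α + 2 = 1 + (α + 1) by ring, Real.rpow_add (by norm_num), Real.rpow_one]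
  rw [e]
  have := Real.pi_pos
  field_simp

/-- From `1 + s ≤ |D|`, the factor `s^k` is absorbed by `|D|^{-k}`, and `|D|^{-j} ≤ 1`. Thus the
higher Laguerre terms decay no worse than the leading one. -/
lemma im_rpow_mul_norm_cayleyDenom_le (α : ℝ) (j k : ℕ) (z : UpperHalfPlane) :
    z.im ^ (1 / 2 + (α / 2 + k)) * ‖cayleyDenom z‖ ^ (-(α / 2 + j + (α / 2 + k) + 1))
      ≤ z.im ^ (1 / 2 + α / 2) * ‖cayleyDenom z‖ ^ (-(α + 1)) := by
  have hs := z.im_pos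
  have hd := norm_cayleyDenom_pos z
  have hle := one_add_im_le_norm_cayleyDenom z
  have e1 : z.im ^ (1 / 2 + (α / 2 + k)) = z.im ^ (1 / 2 + α / 2) * z.im ^ k := by
    rw [← add_assoc, Real.rpow_add hs, Real.rpow_natCast]
  have e2 : ‖cayleyDenom z‖ ^ (-(α / 2 + j + (α / 2 + k) + 1))
      = ‖cayleyDenom z‖ ^ (-(α + 1)) * (‖cayleyDenom z‖ ^ (j + k))⁻¹ := by
    rw [← Real.rpow_natCast, ← Real.rpow_neg hd.le, ← Real.rpow_add hd]
    congr 1; push_cast; ring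
  have h : z.im ^ k * (‖cayleyDenom z‖ ^ (j + k))⁻¹ ≤ 1 := by
    rw [← div_eq_mul_inv, div_le_one (by positivity), pow_add]
    calc z.im ^ k ≤ ‖cayleyDenom z‖ ^ k := pow_le_pow_left₀ hs.le (by linarith) k
      _ ≤ ‖cayleyDenom z‖ ^ j * ‖cayleyDenom z‖ ^ k :=
        le_mul_of_one_le_left (by positivity) (one_le_pow₀ (by linarith))
  rw [e1, e2]
  calc _ = (z.im ^ (1 / 2 + α / 2) * ‖cayleyDenom z‖ ^ (-(α + 1))) *
        (z.im ^ k * (‖cayleyDenom z‖ ^ (j + k))⁻¹) := by ring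
    _ ≤ _ := mul_le_of_le_one_right (by positivity) h

theorem exists_norm_waveletTransform_psi_le (n : ℕ) {α : ℝ} (hα : 0 < α) :
    ∃ C : ℝ, ∀ z : UpperHalfPlane,
      ‖waveletTransform (psi n α hα) (psi n α hα) z‖ ≤ C * poissonPower ((α + 1) / 2) z := by
  let c : ℕ → ℕ → ℝ := fun j k => ‖psiCoeff n α j * psiCoeff n α k‖ *
    (Real.Gamma (α / 2 + j + (α / 2 + k) + 1) / (2 * Real.pi))
  -- Division by `2^{α+1}` offsets the constant carried by `poissonPower ((α + 1) / 2)`.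
  refine ⟨∑ j ∈ Finset.range (n + 1), ∑ k ∈ Finset.range (n + 1), c j k / 2 ^ (α + 1),
    fun z => ?_⟩
  have hs := z.im_pos
  rw [waveletTransform_psi_eq_sum, Finset.sum_mul]
  refine norm_sum_le_of_le _ fun j _ => ?_
  rw [Finset.sum_mul]
  refine norm_sum_le_of_le _ fun k _ => ?_
  have hΓ : 0 < Real.Gamma (α / 2 + j + (α / 2 + k) + 1) := Real.Gamma_pos_of_pos (by positivity)
  have hc : 0 ≤ c j k := by positivity
  rw [norm_mul, Complex.norm_real, norm_one_div_cayleyDenom_cpow, norm_mul (psiCoeff n α j * _),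
    Real.norm_of_nonneg (r := _ / (2 * Real.pi)) (by positivity), poissonPower_eq_norm]
  calc _ = c j k * (z.im ^ (1 / 2 + (α / 2 + k)) *
        ‖cayleyDenom z‖ ^ (-(α / 2 + j + (α / 2 + k) + 1))) := by simp only [c]; ring
    _ ≤ c j k * (z.im ^ (1 / 2 + α / 2) * ‖cayleyDenom z‖ ^ (-(α + 1))) :=
      mul_le_mul_of_nonneg_left (im_rpow_mul_norm_cayleyDenom_le α j k z) hc
    _ = _ := by
      have : (0 : ℝ) < 2 ^ (α + 1) := by positivity
      field_simp

end

theorem mainTheorem12 :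
    (∀ (n : ℕ) (α : ℝ) (hα : 1 < α),
      Integrable
        (fun z : UpperHalfPlane =>
          ‖waveletTransform (psi n α (zero_lt_one.trans hα)) (psi n α (zero_lt_one.trans hα)) z‖)
        (volume : Measure UpperHalfPlane)) ∧
    (∀ (α p : ℝ) (hα : 0 < α), 0 < (α + 1) * p - 2 →
      Integrable
        (fun z : UpperHalfPlane => ‖waveletTransform (psi 0 α hα) (psi 0 α hα) z‖ ^ p)
        (volume : Measure UpperHalfPlane) ∧
      ∫ z : UpperHalfPlane, ‖waveletTransform (psi 0 α hα) (psi 0 α hα) z‖ ^ p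
          ∂(volume : Measure UpperHalfPlane)
        = 8 * Real.pi / ((α + 1) * p - 2)) := by
  refine ⟨fun n α hα => ?_, fun α p hα hp => ?_⟩
  · obtain ⟨C, hC⟩ := exists_norm_waveletTransform_psi_le n (zero_lt_one.trans hα)
    -- The condition `(α + 1)/2 > 1` is precisely `α > 1`.
    refine ((integrable_poissonPower (q := (α + 1) / 2) (by linarith)).const_mul C).mono'
      (measurable_waveletTransform_psi n _).norm.aestronglyMeasurable (ae_of_all _ fun z => ?_)
    rw [norm_norm]
    exact hC z
  -- Here `q = (α + 1)p/2`, so `q > 1` is the hypothesis, and `4π/(q - 1)` is the claimed value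
  -- after doubling numerator and denominator.
  · have hq : 1 < (α + 1) / 2 * p := by linarith
    simp_rw [norm_waveletTransform_psi_zero hα, poissonPower_rpow]
    refine ⟨integrable_poissonPower hq, ?_⟩
    rw [integral_poissonPower hq]
    have h1 : (α + 1) / 2 * p - 1 ≠ 0 := by linarith
    rw [div_eq_div_iff h1 hp.ne']
    ring
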